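/- Let $n\ge 1$, let $e_1$ be the first standard basis vector of $\mathbb{R}^n$, and let $F:\mathbb{R}^n\to\mathbb{R}$ be locally Lipschitz with $$F(se_1)=s\quad\text{for } s\in[0,1],\qquad F(se_1)\le s\quad\text{for } s\in[-1,0].$$ Let $g(x)=\max\{1-|x_1|,0\}$ for $x\in\mathbb{R}^n$. For $\varepsilon\in(0,\tfrac14)$ let $u^\varepsilon\in C(\mathbb{R}^n\times[0,\infty))$ be the viscosity solution of $$u^\varepsilon_t+F(Du^\varepsilon)=\varepsilon\Delta u^\varepsilon \ \text{ in } \mathbb{R}^n\times(0,\infty),\qquad u^\varepsilon(\cdot,0)=g \ \text{ on } \mathbb{R}^n,$$ and let $u\in C(\mathbb{R}^n\times[0,\infty))$ be the viscosity solution of $$u_t+F(Du)=0 \ \text{ in } \mathbb{R}^n\times(0,\infty),\qquad u(\cdot,0)=g \ \text{ on } \mathbb{R}^n,$$ where solutions are understood to be bounded on $\mathbb{R}^n\times[0,T]$ for every $T>0$ (the usual uniqueness class). Then, for every $\varepsilon\in(0,\tfrac14)$, $$|u^\varepsilon(0,1)-u(0,1)|\ \ge\ \frac{\mathrm{e}-1}{\sqrt{\pi}\,\mathrm{e}}\,\sqrt{\varepsilon}.$$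 -/

import Mathlib

open Set Filter Topology

/-- `φ` is of class `C²` on `ℝⁿ × (0,∞)`. -/
def IsTestFunction {n : ℕ} (φ : EuclideanSpace ℝ (Fin n) × ℝ → ℝ) : Prop :=
  ContDiffOn ℝ 2 φ (univ ×ˢ Ioi (0 : ℝ))

/-- The value `φ_t + F(Dφ) - ε Δφ` at `(x, t)`, where `D` and `Δ` act on the space variable. -/
noncomputable def viscousHJ {n : ℕ} (F : EuclideanSpace ℝ (Fin n) → ℝ) (ε : ℝ)
    (φ : EuclideanSpace ℝ (Fin n) × ℝ → ℝ) (x : EuclideanSpace ℝ (Fin n)) (t : ℝ) : ℝ :=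
  deriv (fun s => φ (x, s)) t + F (gradient (fun y => φ (y, t)) x)
    - ε * Laplacian.laplacian (fun y => φ (y, t)) x

/-- `u` is a viscosity subsolution of `u_t + F(Du) = ε Δu` in `ℝⁿ × (0,∞)`:
the inequality `≤` holds for every test function touching `u` from above. -/
def IsViscositySubsolution {n : ℕ} (F : EuclideanSpace ℝ (Fin n) → ℝ) (ε : ℝ)
    (u : EuclideanSpace ℝ (Fin n) × ℝ → ℝ) : Prop :=
  ∀ φ : EuclideanSpace ℝ (Fin n) × ℝ → ℝ, IsTestFunction φ →
    ∀ (x : EuclideanSpace ℝ (Fin n)) (t : ℝ), 0 < t →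
      IsLocalMax (fun z => u z - φ z) (x, t) → viscousHJ F ε φ x t ≤ 0

/-- `u` is a viscosity supersolution of `u_t + F(Du) = ε Δu` in `ℝⁿ × (0,∞)`:
the inequality `≥` holds for every test function touching `u` from below. -/
def IsViscositySupersolution {n : ℕ} (F : EuclideanSpace ℝ (Fin n) → ℝ) (ε : ℝ)
    (u : EuclideanSpace ℝ (Fin n) × ℝ → ℝ) : Prop :=
  ∀ φ : EuclideanSpace ℝ (Fin n) × ℝ → ℝ, IsTestFunction φ →
    ∀ (x : EuclideanSpace ℝ (Fin n)) (t : ℝ), 0 < t →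
      IsLocalMin (fun z => u z - φ z) (x, t) → 0 ≤ viscousHJ F ε φ x t

/-- `u ∈ C(ℝⁿ × [0,∞))` is a viscosity solution of the Cauchy problem
`u_t + F(Du) = ε Δu` in `ℝⁿ × (0,∞)`, `u(·,0) = g`, in the class in which this problem is
well posed for bounded Lipschitz `g`: the functions bounded on `ℝⁿ × [0,T]` for every `T`.
For `ε = 0` this is the first-order problem. Values of `u` at negative times play no role. -/
structure IsViscositySolution {n : ℕ} (F : EuclideanSpace ℝ (Fin n) → ℝ) (ε : ℝ)
    (g : EuclideanSpace ℝ (Fin n) → ℝ) (u : EuclideanSpace ℝ (Fin n) × ℝ → ℝ) : Prop where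
  continuousOn : ContinuousOn u (univ ×ˢ Ici (0 : ℝ))
  bounded : ∀ T : ℝ, 0 < T → ∃ C : ℝ, ∀ (x : EuclideanSpace ℝ (Fin n)) (t : ℝ),
    0 ≤ t → t ≤ T → |u (x, t)| ≤ C
  initial : ∀ x : EuclideanSpace ℝ (Fin n), u (x, 0) = g x
  subsolution : IsViscositySubsolution F ε u
  supersolution : IsViscositySupersolution F ε u

/-! On slopes `s ∈ [0,1]` in the direction `e₁` the equation is transport with unit speed, so
`(0,1)` lies on the left foot `y = -1` of the transported hat. There the inviscid solution is at
most `0`, while diffusion lifts the viscous one by order `√ε`.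

Upper bound (`inviscid_le_zero`): a smoothed ramp `max (y - t + 1) 0` has slopes in `[0,1]`, hence
solves the inviscid equation exactly; it dominates `g` at time `0` and tends to `0` at `(0,1)`.

Lower bound (`heatHat_le_viscous`): the heat flow of the hat, carried with unit speed, has slopes in
`[-1,1]`, where `F (s e₁) ≤ s`, hence is a classical subsolution. With `σ = √(2 ε s)`, `φ` the
normal density and `ψ(z) = E max(z + Z, 0)`, its value at the foot is `σ (ψ(0) - 2 ψ(-1/σ) +
ψ(-2/σ))`. Here `ψ(0) = φ(0)`, the last term is nonnegative, and a Mills ratio bound gives `2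
ψ(-1/σ) ≤ φ(1/σ) ≤ φ(0)/e` (`le_heatHat`).

Both bounds rest on the comparison `IsViscositySubsolution.le_of_supersolution`. -/

/-! ### Gaussian density, distribution function and ramp. -/

/-- The standard normal density. -/
noncomputable def normalDensity (z : ℝ) : ℝ := Real.exp (-(1 / 2) * z ^ 2) / √(2 * Real.pi)

/-- The standard normal distribution function. -/
noncomputable def normalCDF (z : ℝ) : ℝ := ∫ s in Iic z, normalDensity s

/-- The expectation of `max (z + Z) 0` for a standard normal variable `Z`. -/
noncomputable def normalRamp (z : ℝ) : ℝ := z * normalCDF z + normalDensity z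

lemma normalDensity_pos (z : ℝ) : 0 < normalDensity z := by
  unfold normalDensity; positivity

lemma normalDensity_neg (z : ℝ) : normalDensity (-z) = normalDensity z := by
  simp [normalDensity]

lemma contDiff_normalDensity {k : WithTop ℕ∞} : ContDiff ℝ k normalDensity := by
  unfold normalDensity; fun_prop

lemma continuous_normalDensity : Continuous normalDensity :=
  (contDiff_normalDensity (k := 0)).continuous

lemma integrable_normalDensity : MeasureTheory.Integrable normalDensity :=
  (integrable_exp_neg_mul_sq (by norm_num : (0 : ℝ) < 1 / 2)).div_const _

lemma integral_normalDensity : ∫ s, normalDensity s = 1 := by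
  unfold normalDensity
  rw [MeasureTheory.integral_div, integral_gaussian,
    show Real.pi / (1 / 2) = 2 * Real.pi by ring]
  exact div_self (by positivity)

lemma hasDerivAt_normalDensity (z : ℝ) :
    HasDerivAt normalDensity (-z * normalDensity z) z := by
  refine ((((hasDerivAt_pow 2 z).const_mul (-(1 / 2) : ℝ)).exp).div_const
    (√(2 * Real.pi))).congr_deriv ?_
  unfold normalDensity
  norm_num
  ring

lemma normalDensity_le_zero (z : ℝ) : normalDensity z ≤ normalDensity 0 := by
  unfold normalDensity
  gcongr ?_ / _
  exact Real.exp_le_exp.2 (by nlinarith [sq_nonneg z])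

lemma tendsto_normalDensity_atBot : Tendsto normalDensity atBot (𝓝 0) := by
  have h2 : Tendsto (fun z : ℝ => z ^ 2) atBot atTop := by
    simpa [Function.comp_def] using
      (tendsto_pow_atTop (two_ne_zero (α := ℕ))).comp (tendsto_neg_atBot_atTop (G := ℝ))
  have h : Tendsto (fun z : ℝ => -(1 / 2) * z ^ 2) atBot atBot :=
    h2.const_mul_atTop_of_neg (by norm_num)
  have h' := (Real.tendsto_exp_atBot.comp h).div_const (√(2 * Real.pi))
  rwa [zero_div] at h'

lemma hasDerivAt_normalCDF (z : ℝ) : HasDerivAt normalCDF (normalDensity z) z := by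
  have h : normalCDF = fun z => normalCDF 0 + ∫ s in (0 : ℝ)..z, normalDensity s := by
    ext z
    rw [← intervalIntegral.integral_Iic_sub_Iic integrable_normalDensity.integrableOn
      integrable_normalDensity.integrableOn]
    simp [normalCDF]
  rw [h]
  exact (continuous_normalDensity.integral_hasStrictDerivAt 0 z).hasDerivAt.const_add _

lemma contDiff_normalCDF : ContDiff ℝ 2 normalCDF := by
  have h : deriv normalCDF = normalDensity := funext fun z => (hasDerivAt_normalCDF z).deriv
  rw [show (2 : WithTop ℕ∞) = 1 + 1 by norm_num, contDiff_succ_iff_deriv, h]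
  exact ⟨fun z => (hasDerivAt_normalCDF z).differentiableAt, by simp, contDiff_normalDensity⟩

lemma contDiff_normalRamp : ContDiff ℝ 2 normalRamp :=
  (contDiff_id.mul contDiff_normalCDF).add contDiff_normalDensity

lemma hasDerivAt_normalRamp (z : ℝ) : HasDerivAt normalRamp (normalCDF z) z := by
  refine (((hasDerivAt_id z).mul (hasDerivAt_normalCDF z)).add
    (hasDerivAt_normalDensity z)).congr_deriv ?_
  simp only [id]
  ring

lemma normalCDF_mono : Monotone normalCDF :=
  monotone_of_hasDerivAt_nonneg hasDerivAt_normalCDF fun z => (normalDensity_pos z).le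

lemma normalCDF_nonneg (z : ℝ) : 0 ≤ normalCDF z :=
  MeasureTheory.setIntegral_nonneg measurableSet_Iic fun s _ => (normalDensity_pos s).le

lemma normalCDF_add_neg (z : ℝ) : normalCDF z + normalCDF (-z) = 1 := by
  have h : normalCDF (-z) = ∫ s in Ioi z, normalDensity s := by
    rw [normalCDF, ← integral_comp_neg_Ioi]
    simp [normalDensity_neg]
  rw [h, normalCDF, ← compl_Iic, MeasureTheory.integral_add_compl measurableSet_Iic
    integrable_normalDensity, integral_normalDensity]

lemma normalCDF_le_one (z : ℝ) : normalCDF z ≤ 1 := by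
  linarith [normalCDF_add_neg z, normalCDF_nonneg (-z)]

lemma integrable_mul_normalDensity : MeasureTheory.Integrable fun s => s * normalDensity s := by
  convert (integrable_mul_exp_neg_mul_sq (by norm_num : (0 : ℝ) < 1 / 2)).div_const
    (√(2 * Real.pi)) using 2
  unfold normalDensity; ring

lemma integral_Iic_mul_normalDensity (z : ℝ) :
    ∫ s in Iic z, s * normalDensity s = -normalDensity z := by
  rw [MeasureTheory.integral_Iic_of_hasDerivAt_of_tendsto' (f := fun s => -normalDensity s)
    (m := 0) (fun s _ => (hasDerivAt_normalDensity s).neg.congr_deriv (by ring))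
    integrable_mul_normalDensity.integrableOn (by simpa using tendsto_normalDensity_atBot.neg)]
  simp

/-- The ramp equals `∫ s in Iic z, (z - s) * normalDensity s`, whose integrand is nonnegative. -/
lemma normalRamp_nonneg (z : ℝ) : 0 ≤ normalRamp z := by
  have h : ∫ s in Iic z, s * normalDensity s ≤ ∫ s in Iic z, z * normalDensity s :=
    MeasureTheory.setIntegral_mono_on integrable_mul_normalDensity.integrableOn
      (integrable_normalDensity.const_mul z).integrableOn measurableSet_Iic
      fun s hs => mul_le_mul_of_nonneg_right hs (normalDensity_pos s).le
  rw [integral_Iic_mul_normalDensity, MeasureTheory.integral_const_mul] at h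
  unfold normalRamp normalCDF
  linarith

lemma normalRamp_sub_neg (z : ℝ) : normalRamp z - normalRamp (-z) = z := by
  have := normalCDF_add_neg z
  unfold normalRamp
  rw [normalDensity_neg]
  linear_combination z * this

lemma max_le_normalRamp (z : ℝ) : max z 0 ≤ normalRamp z :=
  max_le (by linarith [normalRamp_sub_neg z, normalRamp_nonneg (-z)]) (normalRamp_nonneg z)

lemma normalRamp_le (z : ℝ) : normalRamp z ≤ max z 0 + normalDensity 0 := by
  unfold normalRamp
  rcases le_total z 0 with h | h
  · rw [max_eq_right h]
    nlinarith [normalDensity_le_zero z, normalCDF_nonneg z]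
  · rw [max_eq_left h]
    nlinarith [normalDensity_le_zero z, normalCDF_le_one z]

lemma tendsto_normalCDF_atBot : Tendsto normalCDF atBot (𝓝 0) := by
  refine squeeze_zero' (Eventually.of_forall normalCDF_nonneg) ?_ tendsto_normalDensity_atBot
  -- For `z ≤ -1`, nonnegativity of the ramp gives `normalCDF z ≤ -z * normalCDF z ≤ normalDensity
  -- z`.
  filter_upwards [eventually_le_atBot (-1)] with z hz
  have := normalRamp_nonneg z
  unfold normalRamp at this
  nlinarith [normalCDF_nonneg z]

/-- The lower Mills ratio bound for the normal tail. -/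
lemma mills_le_normalCDF (z : ℝ) : -z * normalDensity z / (1 + z ^ 2) ≤ normalCDF z := by
  -- The difference of the two sides is increasing and vanishes at `-∞`.
  have hd (z : ℝ) : HasDerivAt (fun z => normalCDF z - -z * normalDensity z / (1 + z ^ 2))
      (2 * normalDensity z / (1 + z ^ 2) ^ 2) z := by
    have hz : 1 + z ^ 2 ≠ 0 := by positivity
    refine ((hasDerivAt_normalCDF z).sub (((hasDerivAt_id z).neg.mul
      (hasDerivAt_normalDensity z)).div ((hasDerivAt_pow 2 z).const_add 1) hz)).congr_deriv ?_
    simp only [Pi.neg_apply, Pi.mul_apply, id]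
    field_simp
    ring
  have hm := monotone_of_hasDerivAt_nonneg hd fun z => by
    have := normalDensity_pos z
    positivity
  have hK : Tendsto (fun z => -z * normalDensity z / (1 + z ^ 2)) atBot (𝓝 0) := by
    refine squeeze_zero_norm (fun z => ?_) tendsto_normalDensity_atBot
    have hp := normalDensity_pos z
    rw [Real.norm_eq_abs, abs_div, abs_mul, abs_neg, abs_of_pos hp,
      abs_of_pos (by positivity : 0 < 1 + z ^ 2), div_le_iff₀ (by positivity), mul_comm]
    gcongr
    nlinarith [sq_nonneg (|z| - 1), sq_abs z, abs_nonneg z]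
  have h := hm.le_of_tendsto (by simpa using tendsto_normalCDF_atBot.sub hK) z
  linarith

/-- The Mills bound gives `normalRamp (-b) ≤ normalDensity b / (1 + b ^ 2)`, and `1 + b ^ 2 ≥ 2`. -/
lemma two_mul_normalRamp_neg_le {b : ℝ} (hb : 1 ≤ b) :
    2 * normalRamp (-b) ≤ normalDensity b := by
  have h := mills_le_normalCDF (-b)
  have hp := normalDensity_pos b
  unfold normalRamp
  rw [normalDensity_neg, neg_neg, div_le_iff₀ (by positivity)] at *
  have h2 : normalDensity b / 2 ≤ b * normalCDF (-b) := by
    by_contra! hc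
    nlinarith [mul_le_mul_of_nonneg_left h (by linarith : 0 ≤ b), sq_nonneg b,
      mul_lt_mul_of_pos_right hc (by positivity : 0 < 1 + b ^ 2),
      mul_le_mul_of_nonneg_left (by nlinarith : 1 ≤ b ^ 2) hp.le]
  linarith

/-! ### Differential calculus of the operator. -/

/-- The Laplacian of a function of one coordinate is its second derivative. -/
lemma laplacian_comp_coord {n : ℕ} (i : Fin n) {h h' : ℝ → ℝ} {h'' : ℝ}
    (x : EuclideanSpace ℝ (Fin n)) (hh : ∀ y, HasDerivAt h (h' y) y)
    (hh' : HasDerivAt h' h'' (x i)) :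
    Laplacian.laplacian (fun y : EuclideanSpace ℝ (Fin n) => h (y i)) x = h'' := by
  let P : EuclideanSpace ℝ (Fin n) →L[ℝ] ℝ := EuclideanSpace.proj i
  have h1 : fderiv ℝ (fun y : EuclideanSpace ℝ (Fin n) => h (y i)) = fun y => h' (y i) • P :=
    funext fun y => ((hh (y i)).comp_hasFDerivAt y P.hasFDerivAt).fderiv
  have h2 : HasFDerivAt (fun y : EuclideanSpace ℝ (Fin n) => h' (y i) • P)
      ((h'' • P).smulRight P) x :=
    (hh'.comp_hasFDerivAt x P.hasFDerivAt).smul_const P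
  rw [InnerProductSpace.laplacian_eq_iteratedFDeriv_orthonormalBasis _
    (EuclideanSpace.basisFun (Fin n) ℝ)]
  simp only [iteratedFDeriv_two_apply, h1, h2.fderiv]
  rw [Finset.sum_eq_single i]
  · simp [P]
  · intro j _ hj
    simp [P, hj.symm]
  · simp

lemma hasGradientAt_comp_coord {n : ℕ} (i : Fin n) {h : ℝ → ℝ} {h' : ℝ}
    (x : EuclideanSpace ℝ (Fin n)) (hh : HasDerivAt h h' (x i)) :
    HasGradientAt (fun y : EuclideanSpace ℝ (Fin n) => h (y i))
      (h' • EuclideanSpace.single i (1 : ℝ)) x := by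
  rw [hasGradientAt_iff_hasFDerivAt]
  refine (hh.hasFDerivAt.comp x
    (EuclideanSpace.proj i : EuclideanSpace ℝ (Fin n) →L[ℝ] ℝ).hasFDerivAt).congr_fderiv ?_
  ext v
  simp [EuclideanSpace.inner_single_left, mul_comm]

lemma laplacian_norm_sq {n : ℕ} (x : EuclideanSpace ℝ (Fin n)) :
    Laplacian.laplacian (fun y : EuclideanSpace ℝ (Fin n) => ‖y‖ ^ 2) x = 2 * n := by
  rw [InnerProductSpace.laplacian_eq_iteratedFDeriv_orthonormalBasis _
    (EuclideanSpace.basisFun (Fin n) ℝ)]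
  obtain ⟨B, hB⟩ : ∃ B : EuclideanSpace ℝ (Fin n) →L[ℝ] EuclideanSpace ℝ (Fin n) →L[ℝ] ℝ,
      ∀ y v, B y v = inner ℝ y v := ⟨innerSL ℝ, fun _ _ => rfl⟩
  have h : fderiv ℝ (fun y : EuclideanSpace ℝ (Fin n) => ‖y‖ ^ 2) = fun y => (2 • B) y := by
    ext y v
    simp [fderiv_norm_sq_apply, hB]
  simp only [iteratedFDeriv_two_apply, h, ContinuousLinearMap.fderiv]
  simp [hB]
  ring

lemma hasGradientAt_norm_sq {n : ℕ} (x : EuclideanSpace ℝ (Fin n)) :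
    HasGradientAt (fun y : EuclideanSpace ℝ (Fin n) => ‖y‖ ^ 2) ((2 : ℝ) • x) x := by
  rw [hasGradientAt_iff_hasFDerivAt]
  refine (hasStrictFDerivAt_norm_sq x).hasFDerivAt.congr_fderiv ?_
  ext v
  simp

lemma HasGradientAt.fun_add {n : ℕ} {f g : EuclideanSpace ℝ (Fin n) → ℝ}
    {f' g' x : EuclideanSpace ℝ (Fin n)} (hf : HasGradientAt f f' x) (hg : HasGradientAt g g' x) :
    HasGradientAt (fun y => f y + g y) (f' + g') x := by
  rw [hasGradientAt_iff_hasFDerivAt] at *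
  rw [map_add]
  exact hf.add hg

lemma IsTestFunction.contDiffAt {n : ℕ} {φ : EuclideanSpace ℝ (Fin n) × ℝ → ℝ}
    (h : IsTestFunction φ) {x : EuclideanSpace ℝ (Fin n)} {t : ℝ} (ht : 0 < t) :
    ContDiffAt ℝ 2 φ (x, t) :=
  ContDiffOn.contDiffAt h ((isOpen_univ.prod isOpen_Ioi).mem_nhds ⟨mem_univ _, ht⟩)

/-- Evaluation of the operator on a function of `x i` and `t`. -/
lemma viscousHJ_comp_coord {n : ℕ} (F : EuclideanSpace ℝ (Fin n) → ℝ) (ε : ℝ) (i : Fin n)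
    {W : ℝ → ℝ → ℝ} {Wy : ℝ → ℝ} {Wt Wyy : ℝ} {x : EuclideanSpace ℝ (Fin n)} {t : ℝ}
    (ht : HasDerivAt (W (x i)) Wt t) (hy : ∀ y, HasDerivAt (fun y => W y t) (Wy y) y)
    (hyy : HasDerivAt Wy Wyy (x i)) :
    viscousHJ F ε (fun z => W (z.1 i) z.2) x t =
      Wt + F (Wy (x i) • EuclideanSpace.single i (1 : ℝ)) - ε * Wyy := by
  unfold viscousHJ
  rw [ht.deriv, laplacian_comp_coord (h := fun y => W y t) i x hy hyy,
    (hasGradientAt_comp_coord (h := fun y => W y t) i x (hy _)).gradient]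

/-- The effect on the operator of adding `η ‖x‖²` and a function of time. -/
lemma viscousHJ_add_norm_sq {n : ℕ} (F : EuclideanSpace ℝ (Fin n) → ℝ) (ε η : ℝ)
    {w : EuclideanSpace ℝ (Fin n) × ℝ → ℝ} (hw : IsTestFunction w) {p : ℝ → ℝ} {p' : ℝ}
    {x : EuclideanSpace ℝ (Fin n)} {t : ℝ} (ht : 0 < t) (hp : HasDerivAt p p' t) :
    viscousHJ F ε (fun z => w z + η * ‖z.1‖ ^ 2 + p z.2) x t =
      deriv (fun s => w (x, s)) t + p' +
        F (gradient (fun y => w (y, t)) x + (2 * η) • x) -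
        ε * (Laplacian.laplacian (fun y => w (y, t)) x + 2 * n * η) := by
  have hc := hw.contDiffAt (x := x) ht
  have hcx : ContDiffAt ℝ 2 (fun y => w (y, t)) x :=
    hc.comp x (contDiffAt_id.prodMk contDiffAt_const)
  have hct : ContDiffAt ℝ 2 (fun s => w (x, s)) t :=
    hc.comp t (contDiffAt_const.prodMk contDiffAt_id)
  have hsq : ContDiff ℝ 2 (fun y : EuclideanSpace ℝ (Fin n) => ‖y‖ ^ 2) := contDiff_norm_sq ℝ
  unfold viscousHJ
  have h1 : deriv (fun s => w (x, s) + η * ‖x‖ ^ 2 + p s) t =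
      deriv (fun s => w (x, s)) t + p' :=
    (((hct.differentiableAt (by simp)).hasDerivAt.add_const _).add hp).deriv
  have h2 : gradient (fun y => w (y, t) + η * ‖y‖ ^ 2 + p t) x =
      gradient (fun y => w (y, t)) x + (2 * η) • x := by
    have hg : HasGradientAt (fun y : EuclideanSpace ℝ (Fin n) => η * ‖y‖ ^ 2)
        ((2 * η) • x) x := by
      have := hasGradientAt_norm_sq x
      rw [hasGradientAt_iff_hasFDerivAt] at *
      refine (this.const_mul η).congr_fderiv ?_
      ext v
      simp
      ring
    have h := ((hcx.differentiableAt (by simp)).hasGradientAt.fun_add hg).fun_add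
      (hasGradientAt_const x (p t))
    rw [h.gradient, add_zero]
  have h3 : Laplacian.laplacian (fun y => w (y, t) + η * ‖y‖ ^ 2 + p t) x =
      Laplacian.laplacian (fun y => w (y, t)) x + 2 * n * η := by
    have e : (fun y => w (y, t) + η * ‖y‖ ^ 2 + p t) =
        (fun y => w (y, t)) + η • (fun y => ‖y‖ ^ 2) + fun _ => p t := rfl
    have hη : ContDiffAt ℝ 2 (η • fun y : EuclideanSpace ℝ (Fin n) => ‖y‖ ^ 2) x :=
      hsq.contDiffAt.const_smul η
    have hs : ContDiffAt ℝ 2 ((fun y => w (y, t)) + η • fun y => ‖y‖ ^ 2) x := hcx.add hη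
    rw [e, hs.laplacian_add contDiffAt_const, hcx.laplacian_add hη,
      InnerProductSpace.laplacian_smul η hsq.contDiffAt, laplacian_norm_sq,
      InnerProductSpace.laplacian_const]
    simp
    ring
  simp only [h1, h2, h3]

lemma viscousHJ_neg {n : ℕ} (F : EuclideanSpace ℝ (Fin n) → ℝ) (ε : ℝ)
    (φ : EuclideanSpace ℝ (Fin n) × ℝ → ℝ) (x : EuclideanSpace ℝ (Fin n)) (t : ℝ) :
    viscousHJ (fun p => -F (-p)) ε (fun z => -φ z) x t = -viscousHJ F ε φ x t := by
  have h1 : gradient (fun y => -φ (y, t)) x = -gradient (fun y => φ (y, t)) x := by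
    unfold gradient
    rw [fderiv_fun_neg, map_neg]
  have h2 : Laplacian.laplacian (fun y => -φ (y, t)) x =
      -Laplacian.laplacian (fun y => φ (y, t)) x :=
    congrFun (InnerProductSpace.laplacian_neg (f := fun y => φ (y, t))) x
  unfold viscousHJ
  rw [h1, h2, deriv.fun_neg]
  simp only [neg_neg]
  ring

/-- This reflection lets a single comparison theorem serve for bounds from above and from below. -/
lemma IsViscositySupersolution.neg {n : ℕ} {F : EuclideanSpace ℝ (Fin n) → ℝ} {ε : ℝ}
    {u : EuclideanSpace ℝ (Fin n) × ℝ → ℝ} (hu : IsViscositySupersolution F ε u) :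
    IsViscositySubsolution (fun p => -F (-p)) ε (fun z => -u z) := by
  intro φ hφ x t ht hmax
  have h := hu (fun z => -φ z) hφ.neg x t ht (by
    have e : (fun z => u z - -φ z) = fun z => -(-u z - φ z) := by
      ext z
      ring
    rw [e]
    exact hmax.neg)
  have e := viscousHJ_neg F ε (fun z => -φ z) x t
  simp only [neg_neg] at e
  linarith

/-! ### Comparison principle. -/

/-- A continuous function changes little under small perturbations of arguments in the closed
unit ball. -/
lemma exists_forall_norm_le_sub_le {n : ℕ} {F : EuclideanSpace ℝ (Fin n) → ℝ} (hF : Continuous F)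
    {κ : ℝ} (hκ : 0 < κ) :
    ∃ ρ > 0, ∀ p q, ‖p‖ ≤ 1 → ‖q‖ ≤ ρ → F p - κ ≤ F (p + q) := by
  have hu : UniformContinuousOn F (Metric.closedBall 0 2) :=
    (isCompact_closedBall _ _).uniformContinuousOn_of_continuous hF.continuousOn
  obtain ⟨δ, hδ, h⟩ := Metric.uniformContinuousOn_iff.1 hu κ hκ
  refine ⟨min 1 (δ / 2), by positivity, fun p q hp hq => ?_⟩
  have hq1 : ‖q‖ ≤ 1 := hq.trans (min_le_left _ _)
  have hq2 : ‖q‖ < δ := (hq.trans (min_le_right _ _)).trans_lt (by linarith)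
  have hd := h p (by simpa using hp.trans one_le_two) (p + q)
    (by simpa using (norm_add_le p q).trans (by linarith)) (by simpa [dist_eq_norm] using hq2)
  rw [Real.dist_eq] at hd
  linarith [(abs_lt.1 hd).2]

/-- Comparison of a viscosity subsolution, bounded above, with a classical supersolution, bounded
below, whose spatial gradient has norm at most one. -/
theorem IsViscositySubsolution.le_of_supersolution {n : ℕ} {F : EuclideanSpace ℝ (Fin n) → ℝ}
    (hF : Continuous F) {ε : ℝ} {u w : EuclideanSpace ℝ (Fin n) × ℝ → ℝ}
    (hu : IsViscositySubsolution F ε u) (huc : ContinuousOn u (univ ×ˢ Ici (0 : ℝ)))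
    (hwc : ContinuousOn w (univ ×ˢ Ici (0 : ℝ))) (hw : IsTestFunction w)
    (hsuper : ∀ x t, 0 < t → 0 ≤ viscousHJ F ε w x t)
    (hgrad : ∀ x t, 0 < t → ‖gradient (fun y => w (y, t)) x‖ ≤ 1)
    (h0 : ∀ x, u (x, 0) ≤ w (x, 0))
    (hb : ∀ T, 0 < T → ∃ C, ∀ x t, 0 ≤ t → t ≤ T → u (x, t) - w (x, t) ≤ C)
    (x₀ : EuclideanSpace ℝ (Fin n)) {t₀ : ℝ} (ht₀ : 0 < t₀) : u (x₀, t₀) ≤ w (x₀, t₀) := by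
  by_contra! hlt
  set d := u (x₀, t₀) - w (x₀, t₀) with hd
  have hd0 : 0 < d := sub_pos.2 hlt
  obtain ⟨C, hC⟩ := hb (t₀ + 1) (by linarith)
  have hC0 : 0 < C := hd0.trans_le (hC x₀ t₀ ht₀.le (by linarith))
  -- With this `κ` the time penalty at `t₀` is `κ * t₀ + κ = d / 3`; the space penalty there is also
  -- at most `d / 3`, so the penalized difference stays positive at `(x₀, t₀)`.
  set κ := d / (3 * (t₀ + 1)) with hκ
  have hκ0 : 0 < κ := by positivity
  obtain ⟨ρ, hρ, hFρ⟩ := exists_forall_norm_le_sub_le hF (half_pos hκ0)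
  obtain ⟨η, hη0, hη1, hη2, hη3⟩ : ∃ η : ℝ, 0 < η ∧ η * ‖x₀‖ ^ 2 ≤ d / 3 ∧
      4 * η * C ≤ ρ ^ 2 ∧ ε * (2 * n * η) ≤ κ / 2 := by
    have h (a : ℝ) {b : ℝ} (hb : 0 < b) : ∀ᶠ η in 𝓝[>] (0 : ℝ), η * a ≤ b := by
      have hc : Tendsto (fun η : ℝ => η * a) (𝓝 0) (𝓝 (0 * a)) :=
        (continuous_mul_const a).tendsto 0
      rw [zero_mul] at hc
      exact nhdsWithin_le_nhds (hc.eventually (eventually_le_nhds hb))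
    obtain ⟨η, ⟨⟨h1, h2⟩, h3⟩, h4⟩ := (((h (‖x₀‖ ^ 2) (by positivity : 0 < d / 3)).and
      (h (4 * C) (by positivity : 0 < ρ ^ 2))).and
      (h (ε * (2 * n)) (half_pos hκ0))).and self_mem_nhdsWithin |>.exists
    exact ⟨η, h4, h1, by linarith, by linarith⟩
  -- The exponential penalty reaches `C` at time `t₀ + 1`, and the quadratic one reaches `C` on the
  -- sphere of radius `R`; this keeps the maximum off both boundaries.
  obtain ⟨l, hl0, hl⟩ : ∃ l : ℝ, 0 < l ∧ C ≤ κ * Real.exp l := by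
    refine ⟨C / κ, by positivity, ?_⟩
    have := Real.add_one_le_exp (C / κ)
    calc C = κ * (C / κ) := by field_simp
      _ ≤ _ := by gcongr; linarith
  obtain ⟨R, hR0, hR, hRx⟩ : ∃ R : ℝ, 0 < R ∧ C ≤ η * R ^ 2 ∧ ‖x₀‖ ≤ R := by
    refine ⟨‖x₀‖ + 1 + C / η, by positivity, ?_, by
      have : 0 < C / η := by positivity
      linarith⟩
    have h1 : 0 < C / η := by positivity
    calc C = η * (C / η) := by field_simp
      _ ≤ η * (‖x₀‖ + 1 + C / η) ^ 2 := by
        gcongr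
        nlinarith [norm_nonneg x₀]
  set p : ℝ → ℝ := fun s => κ * s + κ * Real.exp (l * (s - t₀)) with hp
  have hpd (s : ℝ) : HasDerivAt p (κ + κ * (Real.exp (l * (s - t₀)) * l)) s := by
    refine (((hasDerivAt_id s).const_mul κ).add
      ((((hasDerivAt_id s).sub_const t₀).const_mul l).exp.const_mul κ)).congr_deriv ?_
    simp
  set φ : EuclideanSpace ℝ (Fin n) × ℝ → ℝ := fun z => w z + η * ‖z.1‖ ^ 2 + p z.2 with hφ
  have hpsmooth : ContDiff ℝ 2 fun z : EuclideanSpace ℝ (Fin n) × ℝ =>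
      η * ‖z.1‖ ^ 2 + p z.2 :=
    (contDiff_const.mul (contDiff_fst.norm_sq ℝ)).add (by simp only [hp]; fun_prop)
  have hφe : φ = fun z => w z + (η * ‖z.1‖ ^ 2 + p z.2) := by
    ext z
    simp only [hφ]
    ring
  have hφt : IsTestFunction φ := by
    rw [hφe]
    exact ContDiffOn.add hw hpsmooth.contDiffOn
  have hφc : ContinuousOn φ (univ ×ˢ Ici (0 : ℝ)) := by
    rw [hφe]
    exact hwc.add hpsmooth.continuous.continuousOn
  obtain ⟨⟨x, t⟩, ⟨hx, ht⟩, hmax⟩ := ((isCompact_closedBall (0 : EuclideanSpace ℝ (Fin n)) R).prod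
    (isCompact_Icc (a := (0 : ℝ)) (b := t₀ + 1))).exists_isMaxOn
    ⟨(x₀, t₀), by simpa using hRx, ht₀.le, by linarith⟩
    ((huc.sub hφc).mono (prod_mono (subset_univ _) fun s hs => hs.1))
  have hpos : 0 < u (x, t) - φ (x, t) := by
    refine lt_of_lt_of_le ?_ (hmax (⟨by simpa using hRx, ht₀.le, by linarith⟩ :
      (x₀, t₀) ∈ Metric.closedBall (0 : EuclideanSpace ℝ (Fin n)) R ×ˢ Icc (0 : ℝ) (t₀ + 1)))
    change 0 < u (x₀, t₀) - φ (x₀, t₀)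
    have : κ * (t₀ + 1) = d / 3 := by
      rw [hκ]
      field_simp
    simp only [hφ, hp, sub_self, mul_zero, Real.exp_zero]
    linarith
  have hexp (s : ℝ) : 0 < κ * Real.exp (l * (s - t₀)) := by positivity
  have hub := hC x t ht.1 ht.2
  have hval : 0 < u (x, t) - w (x, t) - η * ‖x‖ ^ 2 - κ * t -
      κ * Real.exp (l * (t - t₀)) := by
    simp only [hφ, hp] at hpos
    linarith
  have hκt : 0 ≤ κ * t := mul_nonneg hκ0.le ht.1
  have hηx : 0 ≤ η * ‖x‖ ^ 2 := by positivity
  have ht0 : 0 < t := by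
    rcases ht.1.eq_or_lt with h | h
    · have := h0 x
      have := hexp t
      simp only at h
      subst h
      linarith
    · exact h
  have ht1 : t < t₀ + 1 := by
    rcases ht.2.eq_or_lt with h | h
    · simp only at h
      subst h
      rw [add_sub_cancel_left, mul_one] at hval
      linarith
    · exact h
  have hxR : ‖x‖ < R := by
    by_contra! hc
    have : η * R ^ 2 ≤ η * ‖x‖ ^ 2 := by gcongr
    linarith [hexp t]
  have hloc : IsLocalMax (fun z => u z - φ z) (x, t) :=
    hmax.isLocalMax (prod_mem_nhds
      (mem_of_superset (Metric.isOpen_ball.mem_nhds (by simpa using hxR))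
        Metric.ball_subset_closedBall) (Icc_mem_nhds ht0 ht1))
  have hle := hu φ hφt x t ht0 hloc
  rw [hφ, viscousHJ_add_norm_sq F ε η hw ht0 (hpd t)] at hle
  -- Positivity at the maximum forces `η * ‖x‖ ^ 2 ≤ C`, so `‖2 η x‖ ^ 2 ≤ 4 * η * C ≤ ρ ^ 2`.
  have hq : ‖(2 * η) • x‖ ≤ ρ := by
    rw [norm_smul, Real.norm_of_nonneg (by positivity)]
    refine le_of_sq_le_sq ?_ hρ.le
    nlinarith [hexp t]
  have h1 := hFρ _ _ (hgrad x t ht0) hq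
  have h2 := hsuper x t ht0
  -- The slope `κ` of the time penalty pays for the errors in `F` and in the Laplacian, `κ / 2`
  -- each; the derivative of the exponential makes the inequality strict.
  have h3 := mul_pos (hexp t) hl0
  unfold viscousHJ at h2
  linarith

/-! ### Heat flow of the ramp and of the hat. -/

/-- The solution at time `s` of the heat equation `N_s = ε N_yy` with initial datum `max y 0`. -/
noncomputable def heatRamp (ε y s : ℝ) : ℝ := √(2 * ε * s) * normalRamp (y / √(2 * ε * s))

section heatRamp

variable {ε s : ℝ}

lemma max_le_heatRamp (hε : 0 < ε) (hs : 0 < s) (y : ℝ) : max y 0 ≤ heatRamp ε y s := by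
  have hσ : 0 < √(2 * ε * s) := by positivity
  have h := mul_le_mul_of_nonneg_left (max_le_normalRamp (y / √(2 * ε * s))) hσ.le
  rwa [mul_max_of_nonneg _ _ hσ.le, mul_zero, mul_div_cancel₀ _ hσ.ne'] at h

lemma heatRamp_le (hε : 0 < ε) (hs : 0 < s) (y : ℝ) :
    heatRamp ε y s ≤ max y 0 + √(2 * ε * s) * normalDensity 0 := by
  have hσ : 0 < √(2 * ε * s) := by positivity
  have h := mul_le_mul_of_nonneg_left (normalRamp_le (y / √(2 * ε * s))) hσ.le
  rwa [mul_add, mul_max_of_nonneg _ _ hσ.le, mul_zero, mul_div_cancel₀ _ hσ.ne'] at h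

lemma hasDerivAt_heatRamp_space (hε : 0 < ε) (hs : 0 < s) (t c y : ℝ) :
    HasDerivAt (fun y => heatRamp ε (y - t + c) s)
      (normalCDF ((y - t + c) / √(2 * ε * s))) y := by
  have hσ : 0 < √(2 * ε * s) := by positivity
  refine (((hasDerivAt_normalRamp _).comp y
    ((((hasDerivAt_id y).sub_const t).add_const c).div_const _)).const_mul _).congr_deriv ?_
  simp only [id]
  field_simp

lemma hasDerivAt_normalCDF_space (t c σ y : ℝ) :
    HasDerivAt (fun y => normalCDF ((y - t + c) / σ)) (normalDensity ((y - t + c) / σ) / σ) y := by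
  refine ((hasDerivAt_normalCDF _).comp y
    ((((hasDerivAt_id y).sub_const t).add_const c).div_const _)).congr_deriv ?_
  simp only [id]
  ring

/-- The time derivative of the heat flow seen from a frame moving with unit speed. -/
lemma hasDerivAt_heatRamp_time (hε : 0 < ε) {δ t : ℝ} (ht : 0 < t + δ) (y c : ℝ) :
    HasDerivAt (fun t => heatRamp ε (y - t + c) (t + δ))
      (ε * (normalDensity ((y - t + c) / √(2 * ε * (t + δ))) / √(2 * ε * (t + δ))) -
        normalCDF ((y - t + c) / √(2 * ε * (t + δ)))) t := by
  have hσ : 0 < √(2 * ε * (t + δ)) := by positivity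
  have h1 : HasDerivAt (fun t => √(2 * ε * (t + δ))) (ε / √(2 * ε * (t + δ))) t := by
    refine ((((hasDerivAt_id t).add_const δ).const_mul (2 * ε)).sqrt
      (by simp only [id]; positivity)).congr_deriv ?_
    simp only [id]
    field_simp
  have h2 := (((hasDerivAt_id t).const_sub y).add_const c).div h1 hσ.ne'
  -- Since `normalRamp z = z * normalCDF z + normalDensity z`, the `z * normalCDF z` terms created
  -- by the changing width cancel.
  refine (h1.mul ((hasDerivAt_normalRamp _).comp t h2)).congr_deriv ?_
  simp only [Pi.div_apply, id, Function.comp_apply, normalRamp]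
  field_simp
  ring

lemma contDiffOn_heatRamp {n : ℕ} (i : Fin n) (hε : 0 < ε) {δ : ℝ} (hδ : 0 < δ) (c : ℝ) :
    ContDiffOn ℝ 2 (fun z : EuclideanSpace ℝ (Fin n) × ℝ =>
      heatRamp ε (z.1 i - z.2 + c) (z.2 + δ)) (univ ×ˢ Ici (0 : ℝ)) := by
  have hσ : ContDiffOn ℝ 2 (fun z : EuclideanSpace ℝ (Fin n) × ℝ => √(2 * ε * (z.2 + δ)))
      (univ ×ˢ Ici (0 : ℝ)) := by
    refine ContDiffOn.sqrt (by fun_prop) fun z hz => ?_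
    have : 0 ≤ z.2 := hz.2
    positivity
  have hl : ContDiff ℝ 2 (fun z : EuclideanSpace ℝ (Fin n) × ℝ => z.1 i - z.2 + c) := by
    fun_prop
  refine hσ.mul (contDiff_normalRamp.comp_contDiffOn (hl.contDiffOn.div hσ fun z hz => ?_))
  have : 0 ≤ z.2 := hz.2
  positivity

end heatRamp

/-- The heat flow of the hat function `max (1 - |y|) 0`. -/
noncomputable def heatHat (ε y s : ℝ) : ℝ :=
  heatRamp ε (y + 1) s - 2 * heatRamp ε (y + 0) s + heatRamp ε (y + -1) s

/-- The hat is a second difference of ramps; writing `+ 0` and `+ -1` makes all three terms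
instances of the lemmas with a general shift `c`. -/
lemma hat_eq (y : ℝ) :
    max (1 - |y|) 0 = max (y + 1) 0 - 2 * max (y + 0) 0 + max (y + -1) 0 := by
  rcases abs_cases y with ⟨h, _⟩ | ⟨h, _⟩ <;> rw [h] <;>
  rcases max_cases (y + 1) 0 with ⟨h1, _⟩ | ⟨h1, _⟩ <;>
  rcases max_cases (y + 0) 0 with ⟨h2, _⟩ | ⟨h2, _⟩ <;>
  rcases max_cases (y + -1) 0 with ⟨h3, _⟩ | ⟨h3, _⟩ <;> rw [h1, h2, h3] <;>
  first
  | (rw [max_eq_left (by linarith)]; linarith)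
  | (rw [max_eq_right (by linarith)]; linarith)

lemma heatHat_le {ε s : ℝ} (hε : 0 < ε) (hs : 0 < s) (y : ℝ) :
    heatHat ε y s ≤ max (1 - |y|) 0 + 2 * (√(2 * ε * s) * normalDensity 0) := by
  rw [hat_eq]
  unfold heatHat
  linarith [heatRamp_le hε hs (y + 1), max_le_heatRamp hε hs (y + 0),
    heatRamp_le hε hs (y + -1)]

lemma normalDensity_zero : normalDensity 0 = 1 / √(2 * Real.pi) := by
  simp [normalDensity]

lemma normalDensity_le_exp_neg_one_mul {b : ℝ} (hb : 2 ≤ b ^ 2) :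
    normalDensity b ≤ normalDensity 0 * Real.exp (-1) := by
  unfold normalDensity
  rw [div_mul_eq_mul_div, ← Real.exp_add]
  gcongr ?_ / _
  exact Real.exp_le_exp.2 (by linarith)

lemma le_heatHat {ε s : ℝ} (hε : 0 < ε) (hs : 0 < s) (hεs : 2 * ε * s ≤ 1 / 2) :
    (Real.exp 1 - 1) / (√Real.pi * Real.exp 1) * √(ε * s) ≤ heatHat ε (-1) s := by
  have hσ : 0 < √(2 * ε * s) := by positivity
  -- The hypothesis `2 * ε * s ≤ 1 / 2` is exactly what yields the factor `exp (-1)`.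
  have hb2 : 2 ≤ (1 / √(2 * ε * s)) ^ 2 := by
    rw [div_pow, Real.sq_sqrt (by positivity), le_div_iff₀ (by positivity)]
    linarith
  have hb1 : 1 ≤ 1 / √(2 * ε * s) := by
    rw [← abs_of_pos (one_div_pos.2 hσ), ← one_le_sq_iff_one_le_abs]
    linarith
  have h1 : heatRamp ε (-1 + 1) s = √(2 * ε * s) * normalDensity 0 := by
    simp [heatRamp, normalRamp]
  have h2 : 2 * heatRamp ε (-1 + 0) s ≤ √(2 * ε * s) * (normalDensity 0 * Real.exp (-1)) := by
    have h := mul_le_mul_of_nonneg_left ((two_mul_normalRamp_neg_le hb1).trans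
      (normalDensity_le_exp_neg_one_mul hb2)) hσ.le
    rw [heatRamp, add_zero, neg_div]
    linarith
  have h3 : 0 ≤ heatRamp ε (-1 + -1) s := (le_max_right _ _).trans (max_le_heatRamp hε hs _)
  have h4 : (Real.exp 1 - 1) / (√Real.pi * Real.exp 1) * √(ε * s) =
      √(2 * ε * s) * normalDensity 0 * (1 - Real.exp (-1)) := by
    rw [normalDensity_zero, Real.exp_neg, mul_assoc 2 ε s, Real.sqrt_mul zero_le_two,
      Real.sqrt_mul zero_le_two]
    field_simp
  rw [h4, heatHat, h1]
  linarith

/-! ### Bounds for the two solutions and conclusion. -/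

section Bounds

variable {n : ℕ} [NeZero n] {F : EuclideanSpace ℝ (Fin n) → ℝ}

lemma apply_smul_single_le
    (hF_pos : ∀ s ∈ Icc (0 : ℝ) 1, F (s • EuclideanSpace.single (0 : Fin n) (1 : ℝ)) = s)
    (hF_neg : ∀ s ∈ Icc (-1 : ℝ) 0, F (s • EuclideanSpace.single (0 : Fin n) (1 : ℝ)) ≤ s)
    {s : ℝ} (hs : |s| ≤ 1) : F (s • EuclideanSpace.single (0 : Fin n) (1 : ℝ)) ≤ s := by
  rcases le_total 0 s with h | h
  · exact (hF_pos s ⟨h, (abs_le.1 hs).2⟩).le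
  · exact hF_neg s ⟨(abs_le.1 hs).1, h⟩

/-- The inviscid solution is at most zero at distance one behind the moving peak. -/
lemma inviscid_le_zero (hF : Continuous F)
    (hF_pos : ∀ s ∈ Icc (0 : ℝ) 1, F (s • EuclideanSpace.single (0 : Fin n) (1 : ℝ)) = s)
    {g : EuclideanSpace ℝ (Fin n) → ℝ} (hg : ∀ x, g x = max (1 - |x 0|) 0)
    {u : EuclideanSpace ℝ (Fin n) × ℝ → ℝ} (hu : IsViscositySolution F 0 g u) :
    u (0, 1) ≤ 0 := by
  have main (δ : ℝ) (hδ : 0 < δ) : u (0, 1) ≤ δ * normalDensity 0 := by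
    -- A travelling ramp smoothed at scale `δ`; its corner reaches the origin at time `1`, where its
    -- value is `δ * normalDensity 0`.
    let W : ℝ → ℝ → ℝ := fun y t => δ * normalRamp ((y - t + 1) / δ)
    have hWy (t y : ℝ) : HasDerivAt (fun y => W y t) (normalCDF ((y - t + 1) / δ)) y := by
      refine (((hasDerivAt_normalRamp _).comp y
        ((((hasDerivAt_id y).sub_const t).add_const 1).div_const δ)).const_mul δ).congr_deriv ?_
      simp only [id]
      field_simp
    have hWt (y t : ℝ) : HasDerivAt (W y) (-normalCDF ((y - t + 1) / δ)) t := by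
      refine (((hasDerivAt_normalRamp _).comp t
        ((((hasDerivAt_id t).const_sub y).add_const 1).div_const δ)).const_mul δ).congr_deriv ?_
      simp only [id]
      field_simp
    have hsmooth : ContDiff ℝ 2 fun z : EuclideanSpace ℝ (Fin n) × ℝ => W (z.1 0) z.2 :=
      contDiff_const.mul (contDiff_normalRamp.comp (by fun_prop))
    have hW (y t : ℝ) : max (y - t + 1) 0 ≤ W y t := by
      have h := mul_le_mul_of_nonneg_left (max_le_normalRamp ((y - t + 1) / δ)) hδ.le
      rwa [mul_max_of_nonneg _ _ hδ.le, mul_zero, mul_div_cancel₀ _ hδ.ne'] at h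
    have h := hu.subsolution.le_of_supersolution hF (w := fun z => W (z.1 0) z.2) hu.continuousOn
      hsmooth.continuous.continuousOn hsmooth.contDiffOn (fun x t _ => by
        rw [viscousHJ_comp_coord F 0 0 (hWt _ _) (hWy t) (hasDerivAt_normalCDF_space _ _ _ _),
          hF_pos _ ⟨normalCDF_nonneg _, normalCDF_le_one _⟩]
        simp) (fun x t _ => by
        rw [(hasGradientAt_comp_coord (h := fun y => W y t) 0 x (hWy t _)).gradient, norm_smul,
          Real.norm_of_nonneg (normalCDF_nonneg _)]
        simpa using normalCDF_le_one _) (fun x => by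
        rw [hu.initial, hg]
        refine le_trans (max_le_max_right _ ?_) (hW _ _)
        linarith [neg_abs_le (x 0)]) (fun T hT => by
        obtain ⟨C, hC⟩ := hu.bounded T hT
        refine ⟨C, fun x t h0 h1 => ?_⟩
        linarith [(abs_le.1 (hC x t h0 h1)).2, (le_max_right _ _).trans (hW (x 0) t)])
      0 one_pos
    simpa [W, normalRamp] using h
  have ht : Tendsto (fun δ : ℝ => δ * normalDensity 0) (𝓝[>] 0) (𝓝 0) := by
    have := (continuous_mul_const (normalDensity 0)).tendsto 0
    rw [zero_mul] at this
    exact this.mono_left nhdsWithin_le_nhds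
  exact ge_of_tendsto ht (eventually_mem_nhdsWithin.mono main)

/-- The viscous solution lies, up to a vanishing error, above the heat flow of the initial hat carried
with unit speed. -/
lemma heatHat_le_viscous (hF : Continuous F)
    (hF_pos : ∀ s ∈ Icc (0 : ℝ) 1, F (s • EuclideanSpace.single (0 : Fin n) (1 : ℝ)) = s)
    (hF_neg : ∀ s ∈ Icc (-1 : ℝ) 0, F (s • EuclideanSpace.single (0 : Fin n) (1 : ℝ)) ≤ s)
    {g : EuclideanSpace ℝ (Fin n) → ℝ} (hg : ∀ x, g x = max (1 - |x 0|) 0)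
    {ε : ℝ} (hε : 0 < ε) {u : EuclideanSpace ℝ (Fin n) × ℝ → ℝ}
    (hu : IsViscositySolution F ε g u) {δ : ℝ} (hδ : 0 < δ) :
    heatHat ε (-1) (1 + δ) - 2 * (√(2 * ε * δ) * normalDensity 0) ≤ u (0, 1) := by
  -- The barrier is negated, to be compared with `-u`. The time shift `δ` makes it smooth up to `t =
  -- 0`; the constant absorbs the excess over the hat of its heat flow at time `δ`.
  let W : ℝ → ℝ → ℝ := fun y t =>
    2 * (√(2 * ε * δ) * normalDensity 0) - heatHat ε (y - t) (t + δ)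
  let P : ℝ → ℝ → ℝ := fun y t => normalCDF ((y - t + 1) / √(2 * ε * (t + δ))) -
    2 * normalCDF ((y - t + 0) / √(2 * ε * (t + δ))) +
    normalCDF ((y - t + -1) / √(2 * ε * (t + δ)))
  let S : ℝ → ℝ → ℝ := fun y t =>
    normalDensity ((y - t + 1) / √(2 * ε * (t + δ))) / √(2 * ε * (t + δ)) -
    2 * (normalDensity ((y - t + 0) / √(2 * ε * (t + δ))) / √(2 * ε * (t + δ))) +
    normalDensity ((y - t + -1) / √(2 * ε * (t + δ))) / √(2 * ε * (t + δ))
  have hWy {t : ℝ} (ht : 0 < t) (y : ℝ) : HasDerivAt (fun y => W y t) (-P y t) y :=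
    (((hasDerivAt_heatRamp_space hε (by positivity) t 1 y).sub
      ((hasDerivAt_heatRamp_space hε (by positivity) t 0 y).const_mul 2)).add
      (hasDerivAt_heatRamp_space hε (by positivity) t (-1) y)).const_sub _
  have hWyy (t y : ℝ) : HasDerivAt (fun y => -P y t) (-S y t) y :=
    (((hasDerivAt_normalCDF_space t 1 _ y).sub
      ((hasDerivAt_normalCDF_space t 0 _ y).const_mul 2)).add
      (hasDerivAt_normalCDF_space t (-1) _ y)).neg
  have hWt {t : ℝ} (ht : 0 < t) (y : ℝ) : HasDerivAt (W y) (P y t - ε * S y t) t := by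
    refine ((((hasDerivAt_heatRamp_time hε (by positivity) y 1).sub
      ((hasDerivAt_heatRamp_time hε (by positivity) y 0).const_mul 2)).add
      (hasDerivAt_heatRamp_time hε (by positivity) y (-1))).const_sub _).congr_deriv ?_
    simp only [P, S]
    ring
  -- `P` is the difference of two adjacent increments of `normalCDF`, both nonnegative with sum at
  -- most `1`.
  have hP (y t : ℝ) : |P y t| ≤ 1 := by
    have h1 : normalCDF ((y - t + 0) / √(2 * ε * (t + δ))) ≤
        normalCDF ((y - t + 1) / √(2 * ε * (t + δ))) := normalCDF_mono (by gcongr; norm_num)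
    have h2 : normalCDF ((y - t + -1) / √(2 * ε * (t + δ))) ≤
        normalCDF ((y - t + 0) / √(2 * ε * (t + δ))) := normalCDF_mono (by gcongr; norm_num)
    have h3 := normalCDF_nonneg ((y - t + -1) / √(2 * ε * (t + δ)))
    have h4 := normalCDF_le_one ((y - t + 1) / √(2 * ε * (t + δ)))
    rw [abs_le]
    constructor <;> simp only [P] <;> linarith
  have hsmooth : ContDiffOn ℝ 2 (fun z : EuclideanSpace ℝ (Fin n) × ℝ => W (z.1 0) z.2)
      (univ ×ˢ Ici (0 : ℝ)) :=
    contDiffOn_const.sub (((contDiffOn_heatRamp 0 hε hδ 1).sub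
      (contDiffOn_const.mul (contDiffOn_heatRamp 0 hε hδ 0))).add
      (contDiffOn_heatRamp 0 hε hδ (-1)))
  have h := hu.supersolution.neg.le_of_supersolution
    (hF.comp continuous_neg).neg (w := fun z => W (z.1 0) z.2) hu.continuousOn.neg
    hsmooth.continuousOn (hsmooth.mono (prod_mono le_rfl Ioi_subset_Ici_self)) (fun x t ht => by
      rw [viscousHJ_comp_coord _ ε 0 (hWt ht _) (hWy ht) (hWyy t _)]
      simp only [Pi.neg_apply, Function.comp_apply, neg_smul, neg_neg]
      -- The diffusion terms cancel, leaving `P - F (P e₁) ≥ 0`.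
      linarith [apply_smul_single_le hF_pos hF_neg (hP (x 0) t)]) (fun x t ht => by
      rw [(hasGradientAt_comp_coord (h := fun y => W y t) 0 x (hWy ht _)).gradient, norm_smul,
        Real.norm_eq_abs, abs_neg]
      simpa using hP _ _) (fun x => by
      have := heatHat_le hε hδ (x 0)
      simp only [W, hu.initial, hg, sub_zero, zero_add]
      linarith) (fun T hT => by
      obtain ⟨C, hC⟩ := hu.bounded T hT
      refine ⟨C + (1 + 2 * (√(2 * ε * (T + δ)) * normalDensity 0)), fun x t h0 h1 => ?_⟩
      have h2 := heatHat_le hε (by positivity : 0 < t + δ) (x 0 - t)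
      have h3 : max (1 - |x 0 - t|) 0 ≤ 1 := max_le (by linarith [abs_nonneg (x 0 - t)]) one_pos.le
      have h4 : √(2 * ε * (t + δ)) * normalDensity 0 ≤ √(2 * ε * (T + δ)) * normalDensity 0 := by
        have := (normalDensity_pos 0).le
        gcongr
      have h5 := mul_nonneg (Real.sqrt_nonneg (2 * ε * δ)) (normalDensity_pos 0).le
      simp only [W]
      linarith [(abs_le.1 (hC x t h0 h1)).1])
    0 one_pos
  simp only [W, PiLp.zero_apply, zero_sub] at h
  linarith

end Bounds

theorem corollary1p4 (n : ℕ) [NeZero n] (F : EuclideanSpace ℝ (Fin n) → ℝ)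
    (hF : LocallyLipschitz F)
    (hF_pos : ∀ s ∈ Set.Icc (0 : ℝ) 1, F (s • EuclideanSpace.single (0 : Fin n) (1 : ℝ)) = s)
    (hF_neg : ∀ s ∈ Set.Icc (-1 : ℝ) 0, F (s • EuclideanSpace.single (0 : Fin n) (1 : ℝ)) ≤ s)
    (g : EuclideanSpace ℝ (Fin n) → ℝ) (hg : ∀ x, g x = max (1 - |x 0|) 0)
    (u : EuclideanSpace ℝ (Fin n) × ℝ → ℝ) (hu : IsViscositySolution F 0 g u)
    (ε : ℝ) (hε : ε ∈ Set.Ioo (0 : ℝ) (1 / 4))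
    (uε : EuclideanSpace ℝ (Fin n) × ℝ → ℝ) (huε : IsViscositySolution F ε g uε) :
    |uε (0, 1) - u (0, 1)| ≥
      (Real.exp 1 - 1) / (Real.sqrt Real.pi * Real.exp 1) * Real.sqrt ε := by
  have hupper := inviscid_le_zero hF.continuous hF_pos hg hu
  set A := (Real.exp 1 - 1) / (√Real.pi * Real.exp 1) with hA
  have hA0 : 0 ≤ A := div_nonneg (by linarith [Real.add_one_le_exp 1]) (by positivity)
  have hlim : Tendsto (fun δ : ℝ => A * √ε - 2 * (√(2 * ε * δ) * normalDensity 0)) (𝓝[>] 0)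
      (𝓝 (A * √ε)) := by
    have hc : Continuous fun δ : ℝ => A * √ε - 2 * (√(2 * ε * δ) * normalDensity 0) := by
      fun_prop
    have := hc.tendsto 0
    simp only [mul_zero, Real.sqrt_zero, zero_mul, sub_zero] at this
    exact this.mono_left nhdsWithin_le_nhds
  have hlower : A * √ε ≤ uε (0, 1) := by
    refine le_of_tendsto hlim ?_
    -- This says `ε * (1 + δ) < 1 / 4`, as `le_heatHat` needs at time `1 + δ`; `ε < 1 / 4` leaves
    -- room for such `δ`.
    have hδ : ∀ᶠ δ in 𝓝[>] (0 : ℝ), δ < 1 / (4 * ε) - 1 := by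
      refine nhdsWithin_le_nhds (eventually_lt_nhds ?_)
      rw [sub_pos, lt_div_iff₀ (by linarith [hε.1])]
      linarith [hε.2]
    filter_upwards [hδ, self_mem_nhdsWithin] with δ hδ1 (hδ0 : 0 < δ)
    have h1 := heatHat_le_viscous hF.continuous hF_pos hF_neg hg hε.1 huε hδ0
    have h2 := le_heatHat hε.1 (by positivity : 0 < 1 + δ) (by
      have := (lt_div_iff₀ (by linarith [hε.1])).1 (lt_sub_iff_add_lt.1 hδ1)
      linarith)
    have h3 : A * √ε ≤ A * √(ε * (1 + δ)) := by
      gcongr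
      nlinarith [hε.1]
    linarith
  exact le_trans (by linarith) (le_abs_self _)
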